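/- Let $R$ be a commutative artinian ring and let $\Lambda$ be an artin $R$-algebra, i.e. an $R$-algebra that is finitely generated as an $R$-module. All modules are finitely generated right $\Lambda$-modules; $l(M)$ denotes the length of $M$, and $rad^i(M)$ its $i$-th iterated radical ($rad^0(M)=M$, and $rad^{i+1}(M)$ is the intersection of the maximal submodules of $rad^i(M)$). A module is uniserial (also called $1$-factor serial) if its submodules are totally ordered by inclusion. A module $M$ of length $l$ is called $n$-factor serial, where $l\ge n>1$, if $M/rad^{l-n}(M)$ is uniserial and $M/rad^{l-n+1}(M)$ is not uniserial. The algebra $\Lambda$ is called right $n$-Nakayama if every indecomposable right $\Lambda$-module is $i$-factor serial for some $1\le i\le n$ and there exists at least one indecomposable $n$-factor serial right $\Lambda$-module. A module is local if it has exactly one maximal submodule. Let $\Lambda$ be a right $4$-Nakayama artin algebra and let $M$ be an indecomposable local right $\Lambda$-module. Then the following statements hold. (a) If $M$ is $4$-factor serial, then $l(M)=5$. (b) If $M$ is $3$-factor serial, then $l(M)=4$. (c) If $M$ is $2$-factor serial, then $l(M)=3$. -/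

import Mathlib

universe u w

/-- A module is uniserial if its submodules are totally ordered by inclusion. -/
def IsUniserialModule (A : Type*) [Ring A] (M : Type*) [AddCommGroup M] [Module A M] : Prop :=
  ∀ N K : Submodule A M, N ≤ K ∨ K ≤ N

/-- A module is indecomposable if it is nonzero and is not the direct sum of two nonzero
submodules. -/
def IsIndecomposableModule (A : Type*) [Ring A] (M : Type*) [AddCommGroup M] [Module A M] : Prop :=
  Nontrivial M ∧ ∀ N K : Submodule A M, IsCompl N K → N = ⊥ ∨ K = ⊥

/-- A (finitely generated) module is local if it has exactly one maximal submodule. -/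
def IsLocalModule (A : Type*) [Ring A] (M : Type*) [AddCommGroup M] [Module A M] : Prop :=
  ∃! N : Submodule A M, IsCoatom N

/-- The iterated radical `rad^i(M)`, as a submodule of `M`: `rad^0(M) = M`, and `rad^(i+1)(M)` is
the radical (the intersection of all maximal submodules) of the module `rad^i(M)`. -/
def radPow (A : Type*) [Ring A] (M : Type*) [AddCommGroup M] [Module A M] : ℕ → Submodule A M
  | 0 => ⊤
  | i + 1 => (Module.jacobson A (radPow A M i)).map (radPow A M i).subtype

/-- `n`-factor serial modules, among the modules of finite length `l`: the `1`-factor serial ones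
are the uniserial ones, and for `1 < n ≤ l` it is required that `M / rad^(l-n)(M)` is uniserial and
`M / rad^(l-n+1)(M)` is not. -/
def IsFactorSerial (n : ℕ) (A : Type*) [Ring A] (M : Type*) [AddCommGroup M] [Module A M] : Prop :=
  ∃ l : ℕ, Module.length A M = l ∧
    ((n = 1 ∧ IsUniserialModule A M) ∨
      (1 < n ∧ n ≤ l ∧ IsUniserialModule A (M ⧸ radPow A M (l - n)) ∧
        ¬ IsUniserialModule A (M ⧸ radPow A M (l - n + 1))))

/-- `Λ` is right `n`-Nakayama if every (finitely generated) indecomposable right `Λ`-module is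
`i`-factor serial for some `1 ≤ i ≤ n`, and some (finitely generated) indecomposable right
`Λ`-module is `n`-factor serial. Right `Λ`-modules are modules over the opposite ring `Λᵐᵒᵖ`. -/
def IsRightNakayama (n : ℕ) (Λ : Type u) [Ring Λ] : Prop :=
  (∀ (M : Type u) [AddCommGroup M] [Module Λᵐᵒᵖ M] [Module.Finite Λᵐᵒᵖ M],
    IsIndecomposableModule Λᵐᵒᵖ M → ∃ i : ℕ, 1 ≤ i ∧ i ≤ n ∧ IsFactorSerial i Λᵐᵒᵖ M) ∧
  ∃ (M : Type u) (_ : AddCommGroup M) (_ : Module Λᵐᵒᵖ M), Module.Finite Λᵐᵒᵖ M ∧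
    IsIndecomposableModule Λᵐᵒᵖ M ∧ IsFactorSerial n Λᵐᵒᵖ M

/-! Put r = l - n. The layers of M above rad^r(M) form a chain, and rad^r(M) has two distinct
maximal submodules. Locality excludes r = 0, and r = 1 is the claim, so r ≥ 2 has to be refuted.
Modulo the intersection of those two maximal submodules, rad^(r-2) > rad^(r-1) > rad^r becomes an
`IsForkedChain` a > b > c = s ⊕ t of lengths 4, 3, 2. Gluing a and b/t along s gives a module of
length 4 + 2 - 1 = 5. It is indecomposable (`isIndecomposableModule_amalgam`) but a sum of two
proper submodules, so by `not_isFactorSerial_of_sup_eq_top` it is i-factor serial for no i < 5,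
against the bound 4. -/

section Lattice

/-- `b` is the greatest element strictly below `a`. -/
def IsGreatestBelow {α : Type*} [PartialOrder α] (b a : α) : Prop :=
  b < a ∧ ∀ k, k < a → k ≤ b

theorem IsGreatestBelow.covBy {α : Type*} [PartialOrder α] {a b : α} (h : IsGreatestBelow b a) :
    b ⋖ a :=
  ⟨h.1, fun _ hbk hka => (h.2 _ hka).not_gt hbk⟩

end Lattice

/-! ### Additivity of length. -/

section Length

variable {A : Type*} [Ring A] {M : Type*} [AddCommGroup M] [Module A M]

theorem map_subtype_eq_bot_iff {N : Submodule A M} {X : Submodule A N} :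
    X.map N.subtype = ⊥ ↔ X = ⊥ := by
  rw [← LinearMap.le_ker_iff_map, Submodule.ker_subtype, le_bot_iff]

theorem length_eq_length_add_length_quotient (N : Submodule A M) :
    Module.length A M = Module.length A N + Module.length A (M ⧸ N) :=
  Module.length_eq_add_of_exact N.subtype N.mkQ N.subtype_injective N.mkQ_surjective
    (LinearMap.exact_subtype_mkQ N)

theorem length_eq_length_ker_add_length_range {M' : Type*} [AddCommGroup M'] [Module A M']
    (f : M →ₗ[A] M') :
    Module.length A M =
      Module.length A (LinearMap.ker f) + Module.length A (LinearMap.range f) := by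
  rw [length_eq_length_add_length_quotient (LinearMap.ker f), f.quotKerEquivRange.length_eq]

theorem CovBy.length_eq {N K : Submodule A M} (h : N ⋖ K) :
    Module.length A K = Module.length A N + 1 := by
  have hs := (covBy_iff_quot_is_simple h.le).mp h
  rw [length_eq_length_add_length_quotient (N.submoduleOf K),
    (Submodule.submoduleOfEquivOfLe h.le).length_eq]
  congr 1
  exact Module.length_eq_one_iff.mpr hs

theorem length_eq_of_isCompl {N K : Submodule A M} (h : IsCompl N K) :
    Module.length A M = Module.length A N + Module.length A K := by
  rw [length_eq_length_add_length_quotient N, (N.quotientEquivOfIsCompl K h).length_eq]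

theorem length_add_length_le_of_disjoint {N K C : Submodule A M} (h : Disjoint N K)
    (hN : N ≤ C) (hK : K ≤ C) :
    Module.length A N + Module.length A K ≤ Module.length A C := by
  rw [← Module.length_prod]
  refine Module.length_le_of_injective
    ((Submodule.inclusion hN).coprod (Submodule.inclusion hK)) ?_
  rintro ⟨x, y⟩ ⟨x', y'⟩ hxy
  have h1 : (x : M) + y = x' + y' := congrArg (C.subtype) hxy
  have h2 : (x : M) - x' = y' - y := by
    rw [sub_eq_sub_iff_add_eq_add, h1, add_comm]
  have h3 := Submodule.disjoint_def.mp h (x - x' : M) (sub_mem x.2 x'.2)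
    (h2 ▸ sub_mem y'.2 y.2)
  rw [h3, eq_comm, sub_eq_zero] at h2
  rw [sub_eq_zero] at h3
  exact Prod.ext (Subtype.ext h3) (Subtype.ext h2.symm)

end Length

/-! ### The amalgam and its indecomposability. -/

section Amalgam

variable {A : Type u} [Ring A] {M : Type w} [AddCommGroup M] [Module A M]

/-- The relations `{(x, y) | x ∈ s, x + y ∈ t}` in `a × b`. -/
def amalgamRel (a b s t : Submodule A M) : Submodule A (a × b) :=
  s.comap (a.subtype ∘ₗ LinearMap.fst A a b) ⊓
    t.comap (a.subtype ∘ₗ LinearMap.fst A a b + b.subtype ∘ₗ LinearMap.snd A a b)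

theorem mem_amalgamRel {a b s t : Submodule A M} {z : a × b} :
    z ∈ amalgamRel a b s t ↔ (z.1 : M) ∈ s ∧ (z.1 : M) + z.2 ∈ t := Iff.rfl

/-- For `s, t ≤ b ≤ a`, with `s` and `t` disjoint, this is the amalgam of `a` and `b ⧸ t` along
their common submodule `s`. -/
abbrev Amalgam (a b s t : Submodule A M) : Type w := (a × b) ⧸ amalgamRel a b s t

namespace Amalgam

variable (a b s t : Submodule A M)

/-- The canonical map from the first module to the amalgam. -/
def inl : a →ₗ[A] Amalgam a b s t := (amalgamRel a b s t).mkQ ∘ₗ LinearMap.inl A a b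

/-- The canonical map from the second module to the amalgam. -/
def inr : b →ₗ[A] Amalgam a b s t := (amalgamRel a b s t).mkQ ∘ₗ LinearMap.inr A a b

variable {a b s t}

theorem inl_injective (hst : Disjoint s t) : Function.Injective (inl a b s t) := by
  rw [← LinearMap.ker_eq_bot, LinearMap.ker_eq_bot']
  intro x hx
  have := (Submodule.Quotient.mk_eq_zero _).mp hx
  rw [mem_amalgamRel] at this
  simp only [LinearMap.inl_apply, ZeroMemClass.coe_zero, add_zero] at this
  exact Subtype.ext (Submodule.disjoint_def.mp hst _ this.1 this.2)

theorem inr_eq_zero {y : b} (hy : (y : M) ∈ t) : inr a b s t y = 0 := by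
  refine (Submodule.Quotient.mk_eq_zero _).mpr ?_
  rw [mem_amalgamRel]
  simpa using hy

theorem inl_eq_inr {x : a} {y : b} (hxy : (x : M) = y) (hx : (x : M) ∈ s) :
    inl a b s t x = inr a b s t y := by
  refine (Submodule.Quotient.eq _).mpr ?_
  rw [mem_amalgamRel]
  rw [hxy] at hx
  simp [hx, hxy]

theorem range_inl_sup_range_inr :
    LinearMap.range (inl a b s t) ⊔ LinearMap.range (inr a b s t) = ⊤ := by
  rw [eq_top_iff]
  rintro z -
  obtain ⟨⟨x, y⟩, rfl⟩ := Submodule.mkQ_surjective _ z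
  refine Submodule.mem_sup.mpr ⟨_, ⟨x, rfl⟩, _, ⟨y, rfl⟩, ?_⟩
  simp only [inl, inr, LinearMap.comp_apply, ← map_add]
  simp

/-- The relations are isomorphic to `s × t` when `s, t ≤ b ≤ a`. -/
def relEquiv (hsb : s ≤ b) (htb : t ≤ b) (hba : b ≤ a) : amalgamRel a b s t ≃ₗ[A] (s × t) where
  toFun z := (⟨z.1.1, (mem_amalgamRel.mp z.2).1⟩, ⟨z.1.1 + z.1.2, (mem_amalgamRel.mp z.2).2⟩)
  invFun z := ⟨(⟨z.1, hba (hsb z.1.2)⟩, ⟨z.2 - z.1, sub_mem (htb z.2.2) (hsb z.1.2)⟩),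
    mem_amalgamRel.mpr (by simp)⟩
  map_add' z z' := by ext <;> simp; abel
  map_smul' r z := by ext <;> simp
  left_inv z := by ext <;> simp
  right_inv z := by ext <;> simp

theorem length_add (hsb : s ≤ b) (htb : t ≤ b) (hba : b ≤ a) :
    Module.length A a + Module.length A b =
      Module.length A s + Module.length A t + Module.length A (Amalgam a b s t) := by
  rw [← Module.length_prod, ← Module.length_prod,
    length_eq_length_add_length_quotient (amalgamRel a b s t),
    (relEquiv hsb htb hba).length_eq]

end Amalgam

/-- Submodules `a > b > c = s ⊕ t` with `s`, `t` simple, such that `b` is the greatest proper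
submodule of `a` and `c` the greatest proper submodule of `b`. -/
structure IsForkedChain (a b c s t : Submodule A M) : Prop where
  ba : IsGreatestBelow b a
  cb : IsGreatestBelow c b
  inf_eq : s ⊓ t = ⊥
  sup_eq : s ⊔ t = c
  bot_covBy_left : ⊥ ⋖ s
  bot_covBy_right : ⊥ ⋖ t

namespace IsForkedChain

variable {a b c s t : Submodule A M} (h : IsForkedChain a b c s t)
include h

theorem left_le : s ≤ c := h.sup_eq ▸ le_sup_left
theorem right_le : t ≤ c := h.sup_eq ▸ le_sup_right

theorem length_left : Module.length A s = 1 := by simpa using h.bot_covBy_left.length_eq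
theorem length_right : Module.length A t = 1 := by simpa using h.bot_covBy_right.length_eq

theorem left_covBy : s ⋖ c := by
  have := h.bot_covBy_right
  rw [← h.inf_eq] at this
  rw [← h.sup_eq]
  exact covBy_sup_of_inf_covBy_right this

theorem length_mid : Module.length A c = 2 := by
  rw [h.left_covBy.length_eq, h.length_left]; rfl

theorem length_rad : Module.length A b = 3 := by
  rw [h.cb.covBy.length_eq, h.length_mid]; rfl

theorem length_top : Module.length A a = 4 := by
  rw [h.ba.covBy.length_eq, h.length_rad]; rfl

theorem length_amalgam : Module.length A (Amalgam a b s t) = 5 := by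
  have := Amalgam.length_add (h.left_le.trans h.cb.1.le) (h.right_le.trans h.cb.1.le) h.ba.1.le
  rw [h.length_top, h.length_rad, h.length_left, h.length_right] at this
  have hne : Module.length A (Amalgam a b s t) ≠ ⊤ := by
    intro h
    rw [h] at this
    exact absurd this (by decide)
  lift Module.length A (Amalgam a b s t) to ℕ using hne with l
  norm_cast at this ⊢
  omega

/-- No map `ρ : b → a` can be the identity on `s` and vanish on `t`. -/
theorem no_retraction (ρ : b →ₗ[A] M) (hρa : LinearMap.range ρ ≤ a)
    (hs : ∀ y : b, (y : M) ∈ s → ρ y = y) (ht : ∀ y : b, (y : M) ∈ t → ρ y = 0) : False := by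
  have hbt : t ≤ b := h.right_le.trans h.cb.1.le
  have hsb : s ≤ b := h.left_le.trans h.cb.1.le
  have hlen := length_eq_length_ker_add_length_range ρ
  rw [h.length_rad] at hlen
  have hker : 1 ≤ Module.length A (LinearMap.ker ρ) := by
    rw [← h.length_right]
    refine Module.length_le_of_injective
      ((Submodule.inclusion hbt).codRestrict (LinearMap.ker ρ) fun y => ht _ y.2) ?_
    intro x y hxy
    have := congrArg (fun z : LinearMap.ker ρ => ((z : b) : M)) hxy
    exact Subtype.ext this
  -- Since `ρ` kills `t`, its image is too short to be `a` or `b`; the two greatest-below properties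
  -- then push it into `c`.
  have hlt : Module.length A (LinearMap.range ρ) < 3 := by
    by_contra! hge
    have : (1 : ℕ∞) + 3 ≤ 3 := by
      calc (1 : ℕ∞) + 3 ≤ _ := add_le_add hker hge
        _ = 3 := hlen.symm
    exact absurd this (by decide)
  have hne : ∀ k : Submodule A M, 3 ≤ Module.length A k → LinearMap.range ρ ≠ k := by
    rintro k hk rfl
    exact absurd hlt hk.not_gt
  have hrb := h.ba.2 _ (lt_of_le_of_ne hρa (hne a (by rw [h.length_top]; decide)))
  have hrc := h.cb.2 _ (lt_of_le_of_ne hrb (hne b h.length_rad.ge))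
  -- `K` is the kernel of `ρ` followed by the projection of `c = s ⊕ t` onto `s`. That composite is
  -- the identity on `s`, so `b = s + K`; as `s ≤ c` is superfluous in `b`, `K = b`, which forces `s
  -- ≤ t`.
  set K : Submodule A M := (t.comap ρ).map b.subtype with hK
  have hKb : K ≤ b := Submodule.map_subtype_le _ _
  have hbs : b ≤ s ⊔ K := by
    intro y hy
    have hy' : ρ ⟨y, hy⟩ ∈ s ⊔ t := h.sup_eq ▸ hrc ⟨_, rfl⟩
    obtain ⟨p, hp, q, hq, hpq⟩ := Submodule.mem_sup.mp hy'
    refine Submodule.mem_sup.mpr ⟨p, hp, y - p, ?_, by abel⟩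
    refine ⟨⟨y, hy⟩ - ⟨p, hsb hp⟩, ?_, rfl⟩
    have : ρ (⟨y, hy⟩ - ⟨p, hsb hp⟩) = q := by
      rw [map_sub, hs ⟨p, hsb hp⟩ hp, ← hpq]
      simp
    change ρ _ ∈ t
    rwa [this]
  have hKeq : K = b := by
    by_contra hKne
    have hKc := h.cb.2 _ (lt_of_le_of_ne hKb hKne)
    exact absurd (hbs.trans (sup_le h.left_le hKc)) h.cb.1.not_ge
  refine h.bot_covBy_left.1.not_ge fun x hx => ?_
  have hxK : x ∈ K := hKeq ▸ hsb hx
  obtain ⟨y, hy, rfl⟩ := hxK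
  rw [← h.inf_eq]
  refine ⟨hx, ?_⟩
  have h1 := hs y hx
  have h2 : ρ y ∈ t := hy
  rwa [h1] at h2

/-- A quotient by a nonzero `N` has length at most 4, so an injection from `a` would be an
isomorphism; its inverse, applied to the image of `b`, would be the map excluded by `no_retraction`.
-/
theorem not_injective_mkQ_comp_inl [IsNoetherian A M] [IsArtinian A M]
    {N : Submodule A (Amalgam a b s t)} (hN : N ≠ ⊥) :
    ¬ Function.Injective (N.mkQ ∘ₗ Amalgam.inl a b s t) := by
  intro hinj
  set f := N.mkQ ∘ₗ Amalgam.inl a b s t with hf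
  have h1 := length_eq_length_add_length_quotient N
  have h2 := Module.length_le_of_injective f hinj
  rw [h.length_amalgam] at h1
  rw [h.length_top] at h2
  have h3 : Module.length A N ≠ 0 := by
    rw [Ne, Module.length_eq_zero_iff, Submodule.subsingleton_iff_eq_bot]
    exact hN
  have h4 : Module.length A (Amalgam a b s t ⧸ N) = 4 := by
    have t1 : Module.length A N ≠ ⊤ := Module.length_ne_top
    have t2 : Module.length A (Amalgam a b s t ⧸ N) ≠ ⊤ := Module.length_ne_top
    lift Module.length A N to ℕ using t1 with m
    lift Module.length A (Amalgam a b s t ⧸ N) to ℕ using t2 with k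
    norm_cast at *
    omega
  have hsurj : Function.Surjective f := by
    rw [← LinearMap.range_eq_top]
    by_contra hne
    have h5 := Submodule.length_lt hne
    rw [h4, ← (LinearEquiv.ofInjective f hinj).length_eq, h.length_top] at h5
    exact lt_irrefl _ h5
  let e := LinearEquiv.ofBijective f ⟨hinj, hsurj⟩
  refine h.no_retraction (a.subtype ∘ₗ e.symm.toLinearMap ∘ₗ N.mkQ ∘ₗ Amalgam.inr a b s t)
    ?_ ?_ ?_
  · rintro _ ⟨y, rfl⟩
    exact Subtype.prop _
  · intro y hy
    have := Amalgam.inl_eq_inr (t := t) (x := ⟨y, h.ba.1.le y.2⟩) (y := y) rfl hy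
    simp only [LinearMap.comp_apply, ← this]
    change ((e.symm (e ⟨y, _⟩) : a) : M) = y
    simp
  · intro y hy
    simp [LinearMap.comp_apply, Amalgam.inr_eq_zero hy]

theorem isIndecomposableModule_amalgam [IsNoetherian A M] [IsArtinian A M] :
    IsIndecomposableModule A (Amalgam a b s t) := by
  refine ⟨Module.length_pos_iff.mp (by rw [h.length_amalgam]; decide), fun N K hNK => ?_⟩
  by_contra! hne
  set f := N.mkQ ∘ₗ Amalgam.inl a b s t with hf
  set g := K.mkQ ∘ₗ Amalgam.inl a b s t with hg
  have hdisj : LinearMap.ker f ⊓ LinearMap.ker g = ⊥ := by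
    rw [eq_bot_iff]
    rintro x ⟨hx1, hx2⟩
    have hx1' : Amalgam.inl a b s t x ∈ N := (Submodule.Quotient.mk_eq_zero _).mp hx1
    have hx2' : Amalgam.inl a b s t x ∈ K := (Submodule.Quotient.mk_eq_zero _).mp hx2
    have := Submodule.disjoint_def.mp hNK.disjoint _ hx1' hx2'
    exact (injective_iff_map_eq_zero _).mp
      (Amalgam.inl_injective (disjoint_iff.mpr h.inf_eq)) x this
  have hfk : LinearMap.ker f ≠ ⊥ := fun hk =>
    h.not_injective_mkQ_comp_inl hne.1 (LinearMap.ker_eq_bot.mp hk)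
  have hgk : LinearMap.ker g ≠ ⊥ := fun hk =>
    h.not_injective_mkQ_comp_inl hne.2 (LinearMap.ker_eq_bot.mp hk)
  -- Of two nonzero disjoint submodules of `a`, neither is `a`, so both lie in `b`; neither is `b`,
  -- so both lie in `c`.
  have key : ∀ X Y : Submodule A a, X ⊓ Y = ⊥ → Y ≠ ⊥ → X ≠ ⊥ → X.map a.subtype ≤ c := by
    intro X Y hXY hY hX
    have hd : X.map a.subtype ⊓ Y.map a.subtype = ⊥ := by
      rw [← Submodule.map_inf _ a.subtype_injective, hXY, Submodule.map_bot]
    have hY' : Y.map a.subtype ≠ ⊥ := by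
      rwa [Ne, map_subtype_eq_bot_iff]
    have hXa : X.map a.subtype ≤ b := by
      refine h.ba.2 _ (lt_of_le_of_ne (Submodule.map_subtype_le _ _) fun he => hY' ?_)
      rw [he] at hd
      exact inf_eq_right.mpr (Submodule.map_subtype_le a Y) ▸ hd
    have hYb : Y.map a.subtype ≤ b := by
      refine h.ba.2 _ (lt_of_le_of_ne (Submodule.map_subtype_le _ _) fun he => hX ?_)
      rw [he, inf_eq_left.mpr (Submodule.map_subtype_le a X),
        map_subtype_eq_bot_iff] at hd
      exact hd
    refine h.cb.2 _ (lt_of_le_of_ne hXa fun he => hY' ?_)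
    rw [he, inf_eq_right.mpr hYb] at hd
    exact hd
  have h1 := length_add_length_le_of_disjoint (C := c)
    (N := (LinearMap.ker f).map a.subtype) (K := (LinearMap.ker g).map a.subtype)
    (disjoint_iff.mpr (by
      rw [← Submodule.map_inf _ a.subtype_injective, hdisj, Submodule.map_bot]))
    (key _ _ hdisj hgk hfk) (key _ _ ((inf_comm _ _).trans hdisj) hfk hgk)
  rw [((LinearMap.ker f).equivMapOfInjective _ a.subtype_injective).symm.length_eq,
    ((LinearMap.ker g).equivMapOfInjective _ a.subtype_injective).symm.length_eq,
    h.length_mid] at h1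
  -- The kernels have total length at most 2, so the ranges have total length at least 8 - 2 = 6.
  -- They embed in `K` and `N`, whose lengths sum to 5.
  have h2 := length_eq_length_ker_add_length_range f
  have h3 := length_eq_length_ker_add_length_range g
  have h4 := Module.length_le_of_injective (LinearMap.range f).subtype
    (Submodule.subtype_injective _)
  have h5 := Module.length_le_of_injective (LinearMap.range g).subtype
    (Submodule.subtype_injective _)
  have h6 := length_eq_of_isCompl hNK
  rw [(N.quotientEquivOfIsCompl K hNK).length_eq] at h4
  rw [(K.quotientEquivOfIsCompl N hNK.symm).length_eq] at h5
  rw [h.length_top] at h2 h3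
  rw [h.length_amalgam] at h6
  have t1 : Module.length A N ≠ ⊤ := Module.length_ne_top
  have t2 : Module.length A K ≠ ⊤ := Module.length_ne_top
  have t3 : Module.length A (LinearMap.ker f) ≠ ⊤ := Module.length_ne_top
  have t4 : Module.length A (LinearMap.ker g) ≠ ⊤ := Module.length_ne_top
  have t5 : Module.length A (LinearMap.range f) ≠ ⊤ := Module.length_ne_top
  have t6 : Module.length A (LinearMap.range g) ≠ ⊤ := Module.length_ne_top
  generalize Module.length A N = n1 at *
  generalize Module.length A K = n2 at *
  generalize Module.length A (LinearMap.ker f) = n3 at *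
  generalize Module.length A (LinearMap.ker g) = n4 at *
  generalize Module.length A (LinearMap.range f) = n5 at *
  generalize Module.length A (LinearMap.range g) = n6 at *
  lift n1 to ℕ using t1
  lift n2 to ℕ using t2
  lift n3 to ℕ using t3
  lift n4 to ℕ using t4
  lift n5 to ℕ using t5
  lift n6 to ℕ using t6
  norm_cast at *
  omega

theorem range_inl_ne_top : LinearMap.range (Amalgam.inl a b s t) ≠ ⊤ := by
  intro htop
  have := Module.length_le_of_surjective _ (LinearMap.range_eq_top.mp htop)
  rw [h.length_amalgam, h.length_top] at this
  exact absurd this (by decide)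

theorem range_inr_ne_top : LinearMap.range (Amalgam.inr a b s t) ≠ ⊤ := by
  intro htop
  have := Module.length_le_of_surjective _ (LinearMap.range_eq_top.mp htop)
  rw [h.length_amalgam, h.length_rad] at this
  exact absurd this (by decide)

end IsForkedChain

end Amalgam

/-! ### The radical series and uniserial quotients. -/

section Radical

variable {A : Type*} [Ring A] {M : Type*} [AddCommGroup M] [Module A M]

theorem map_subtype_covBy_iff {X : Submodule A M} {E : Submodule A X} :
    E.map X.subtype ⋖ X ↔ IsCoatom E := by
  rw [← (Submodule.mapIic X).isCoatom_iff E, Set.Iic.isCoatom_iff]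
  rfl

theorem radPow_succ_le_of_covBy {i : ℕ} {D : Submodule A M} (h : D ⋖ radPow A M i) :
    radPow A M (i + 1) ≤ D := by
  have hD : (D.comap (radPow A M i).subtype).map (radPow A M i).subtype = D := by
    rw [Submodule.map_comap_subtype, inf_eq_right.mpr h.le]
  rw [← hD]
  refine Submodule.map_mono (sInf_le ?_)
  rw [Set.mem_ofPred_eq, ← map_subtype_covBy_iff, hD]
  exact h

theorem le_radPow_succ {i : ℕ} {D : Submodule A M} (hD : D ≤ radPow A M i)
    (h : ∀ D', D' ⋖ radPow A M i → D ≤ D') : D ≤ radPow A M (i + 1) := by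
  have hD' : (D.comap (radPow A M i).subtype).map (radPow A M i).subtype = D := by
    rw [Submodule.map_comap_subtype, inf_eq_right.mpr hD]
  rw [← hD']
  refine Submodule.map_mono (le_sInf fun E hE => ?_)
  exact Submodule.map_le_iff_le_comap.mp
    ((h _ (map_subtype_covBy_iff.mpr hE)).trans' hD'.le) |>.trans
    (Submodule.comap_map_eq_of_injective (Submodule.subtype_injective _) E).le

theorem radPow_succ_le (i : ℕ) : radPow A M (i + 1) ≤ radPow A M i :=
  Submodule.map_subtype_le _ _

theorem radPow_antitone : Antitone (radPow A M) :=
  antitone_nat_of_succ_le radPow_succ_le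

theorem isGreatestBelow_radPow_succ [IsNoetherian A M] {i : ℕ} (hne : radPow A M i ≠ ⊥)
    (huniq : ∀ D D', D ⋖ radPow A M i → D' ⋖ radPow A M i → D = D') :
    IsGreatestBelow (radPow A M (i + 1)) (radPow A M i) := by
  obtain ⟨D, -, hD⟩ := exists_le_covBy_of_lt (bot_lt_iff_ne_bot.mpr hne)
  have heq : radPow A M (i + 1) = D :=
    le_antisymm (radPow_succ_le_of_covBy hD)
      (le_radPow_succ hD.le fun D' hD' => (huniq D D' hD hD').le)
  rw [heq]
  refine ⟨hD.lt, fun K hK => ?_⟩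
  obtain ⟨D', hKD', hD'⟩ := exists_le_covBy_of_lt hK
  exact huniq D D' hD hD' ▸ hKD'

theorem isUniserialModule_quotient_iff {Z : Submodule A M} :
    IsUniserialModule A (M ⧸ Z) ↔ ∀ N K : Submodule A M, Z ≤ N → Z ≤ K → N ≤ K ∨ K ≤ N := by
  constructor
  · intro h N K hN hK
    refine (h (N.map Z.mkQ) (K.map Z.mkQ)).imp (fun hle => ?_) fun hle => ?_ <;>
    · have := Submodule.comap_mono (f := Z.mkQ) hle
      rwa [Submodule.comap_map_mkQ, Submodule.comap_map_mkQ, sup_eq_right.mpr hN,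
        sup_eq_right.mpr hK] at this
  · intro h N K
    exact (h _ _ (Submodule.le_comap_mkQ Z N) (Submodule.le_comap_mkQ Z K)).imp
      (Submodule.comap_le_comap_iff_of_surjective Z.mkQ_surjective).mp
      (Submodule.comap_le_comap_iff_of_surjective Z.mkQ_surjective).mp

theorem le_radPow_or_exists_eq {t : ℕ}
    (h : ∀ i < t, IsGreatestBelow (radPow A M (i + 1)) (radPow A M i)) (K : Submodule A M) :
    K ≤ radPow A M t ∨ ∃ i < t, K = radPow A M i := by
  induction t with
  | zero => exact Or.inl le_top
  | succ t ih =>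
    rcases ih fun i hi => h i (hi.trans (Nat.lt_succ_self t)) with hK | ⟨i, hi, rfl⟩
    · rcases hK.eq_or_lt with rfl | hlt
      · exact Or.inr ⟨t, Nat.lt_succ_self t, rfl⟩
      · exact Or.inl ((h t (Nat.lt_succ_self t)).2 K hlt)
    · exact Or.inr ⟨i, hi.trans (Nat.lt_succ_self t), rfl⟩

theorem isUniserialModule_quotient_radPow {t : ℕ}
    (h : ∀ i < t, IsGreatestBelow (radPow A M (i + 1)) (radPow A M i)) :
    IsUniserialModule A (M ⧸ radPow A M t) := by
  have key : ∀ K, radPow A M t ≤ K → ∃ i, K = radPow A M i := fun K hK =>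
    (le_radPow_or_exists_eq h K).elim (fun hle => ⟨t, le_antisymm hle hK⟩)
      fun ⟨i, _, hi⟩ => ⟨i, hi⟩
  rw [isUniserialModule_quotient_iff]
  intro N K hN hK
  obtain ⟨i, rfl⟩ := key N hN
  obtain ⟨j, rfl⟩ := key K hK
  exact (le_total j i).imp (fun hij => radPow_antitone hij) fun hij => radPow_antitone hij

theorem isGreatestBelow_of_isUniserialModule_quotient [IsNoetherian A M] {t : ℕ}
    (h : IsUniserialModule A (M ⧸ radPow A M t)) {i : ℕ} (hi : i < t)
    (hne : radPow A M i ≠ ⊥) : IsGreatestBelow (radPow A M (i + 1)) (radPow A M i) := by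
  rw [isUniserialModule_quotient_iff] at h
  refine isGreatestBelow_radPow_succ hne fun D D' hD hD' => ?_
  have hti : radPow A M t ≤ radPow A M (i + 1) := radPow_antitone hi
  rcases h D D' (hti.trans (radPow_succ_le_of_covBy hD))
    (hti.trans (radPow_succ_le_of_covBy hD')) with hle | hle
  · exact (hD.eq_or_eq hle hD'.le).elim Eq.symm fun he => absurd he hD'.ne
  · exact (hD'.eq_or_eq hle hD.le).elim id fun he => absurd he hD.ne

/-- If `radPow A M t` were zero, the next term would equal it and both quotients would agree. So it
is nonzero, and a unique maximal submodule would extend the chain by one layer. -/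
theorem exists_covBy_radPow_ne [IsNoetherian A M] {t : ℕ}
    (h : IsUniserialModule A (M ⧸ radPow A M t))
    (h' : ¬ IsUniserialModule A (M ⧸ radPow A M (t + 1))) :
    (∀ i < t, IsGreatestBelow (radPow A M (i + 1)) (radPow A M i)) ∧
      ∃ D D', D ≠ D' ∧ D ⋖ radPow A M t ∧ D' ⋖ radPow A M t := by
  have hne : radPow A M t ≠ ⊥ := by
    intro hbot
    have : radPow A M (t + 1) = radPow A M t :=
      le_antisymm (radPow_succ_le t) (hbot.le.trans bot_le)
    rw [this] at h'
    exact h' h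
  have hchain : ∀ i < t, IsGreatestBelow (radPow A M (i + 1)) (radPow A M i) := fun i hi =>
    isGreatestBelow_of_isUniserialModule_quotient h hi fun hbot =>
      hne (le_bot_iff.mp ((radPow_antitone hi.le).trans hbot.le))
  refine ⟨hchain, ?_⟩
  by_contra! hall
  refine h' (isUniserialModule_quotient_radPow fun i hi => ?_)
  rcases (Nat.lt_succ_iff.mp hi).eq_or_lt with rfl | hlt
  · exact isGreatestBelow_radPow_succ hne fun D D' hD hD' => by
      by_contra hDD'
      exact hall D D' hDD' hD hD'
  · exact hchain i hlt

/-- For `n < l` the quotient in the definition maps onto the top of `M`, which has two incomparable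
maximal submodules, one over `U` and one over `V`. -/
theorem not_isFactorSerial_of_sup_eq_top [IsNoetherian A M] {U V : Submodule A M}
    (hUV : U ⊔ V = ⊤) (hU : U ≠ ⊤) (hV : V ≠ ⊤) {n l : ℕ} (hl : Module.length A M = l)
    (hn : n < l) : ¬ IsFactorSerial n A M := by
  rintro ⟨l', hl', ⟨-, hM⟩ | ⟨-, -, hM, -⟩⟩
  · rcases hM U V with hle | hle
    · exact hV (by rwa [sup_eq_right.mpr hle] at hUV)
    · exact hU (by rwa [sup_eq_left.mpr hle] at hUV)
  · obtain rfl : l = l' := by exact_mod_cast hl.symm.trans hl'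
    obtain ⟨D, hUD, hD⟩ := exists_le_covBy_of_lt hU.lt_top
    obtain ⟨D', hVD', hD'⟩ := exists_le_covBy_of_lt hV.lt_top
    have hrad : radPow A M (l - n) ≤ radPow A M 1 := radPow_antitone (by omega)
    have hle : ∀ E, E ⋖ ⊤ → radPow A M (l - n) ≤ E := fun E hE =>
      hrad.trans (radPow_succ_le_of_covBy (i := 0) hE)
    rcases isUniserialModule_quotient_iff.mp hM D D' (hle D hD) (hle D' hD') with h | h
    · exact hD'.ne (top_le_iff.mp (hUV ▸ sup_le (hUD.trans h) hVD'))
    · exact hD.ne (top_le_iff.mp (hUV ▸ sup_le hUD (hVD'.trans h)))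

end Radical

/-! ### Passage to quotients, producing the forked chain. -/

section Quotient

variable {A : Type*} [Ring A] {M : Type*} [AddCommGroup M] [Module A M] {Y : Submodule A M}

theorem map_mkQ_lt_map_mkQ {x y : Submodule A M} (hx : Y ≤ x) (h : x < y) :
    x.map Y.mkQ < y.map Y.mkQ := by
  refine lt_of_le_not_ge (Submodule.map_mono h.le) fun hle => h.not_ge ?_
  have := Submodule.map_le_iff_le_comap.mp hle
  rwa [Submodule.comap_map_mkQ, sup_eq_right.mpr hx] at this

theorem lt_of_map_mkQ_lt_map_mkQ {x y : Submodule A M} (hy : Y ≤ y)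
    (h : x.map Y.mkQ < y.map Y.mkQ) : x < y := by
  refine lt_of_le_not_ge ?_ fun hle => h.not_ge (Submodule.map_mono hle)
  have := Submodule.map_le_iff_le_comap.mp h.le
  rwa [Submodule.comap_map_mkQ, sup_eq_right.mpr hy] at this

theorem map_comap_mkQ (K : Submodule A (M ⧸ Y)) : (K.comap Y.mkQ).map Y.mkQ = K :=
  Submodule.map_comap_eq_of_surjective Y.mkQ_surjective K

theorem IsGreatestBelow.map_mkQ {x y : Submodule A M} (h : IsGreatestBelow x y) (hx : Y ≤ x) :
    IsGreatestBelow (x.map Y.mkQ) (y.map Y.mkQ) := by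
  refine ⟨map_mkQ_lt_map_mkQ hx h.1, fun K hK => ?_⟩
  rw [← map_comap_mkQ K] at hK ⊢
  exact Submodule.map_mono (h.2 _ (lt_of_map_mkQ_lt_map_mkQ (hx.trans h.1.le) hK))

theorem CovBy.map_mkQ {x y : Submodule A M} (h : x ⋖ y) (hx : Y ≤ x) :
    x.map Y.mkQ ⋖ y.map Y.mkQ := by
  refine ⟨map_mkQ_lt_map_mkQ hx h.lt, fun K hxK hKy => ?_⟩
  rw [← map_comap_mkQ K] at hxK hKy
  exact h.2 (lt_of_map_mkQ_lt_map_mkQ (Submodule.le_comap_mkQ Y K) hxK)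
    (lt_of_map_mkQ_lt_map_mkQ (hx.trans h.le) hKy)

theorem isForkedChain_map_mkQ {a b c d d' : Submodule A M} (hba : IsGreatestBelow b a)
    (hcb : IsGreatestBelow c b) (hdd' : d ≠ d') (hd : d ⋖ c) (hd' : d' ⋖ c) :
    IsForkedChain (a.map (d ⊓ d').mkQ) (b.map (d ⊓ d').mkQ) (c.map (d ⊓ d').mkQ)
      (d.map (d ⊓ d').mkQ) (d'.map (d ⊓ d').mkQ) := by
  have hc : d ⊓ d' ≤ c := inf_le_left.trans hd.le
  have hsup : d ⊔ d' = c := hd.wcovBy.sup_eq hd'.wcovBy hdd'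
  have hbot : (d ⊓ d').map (d ⊓ d').mkQ = ⊥ := by
    rw [← LinearMap.le_ker_iff_map, Submodule.ker_mkQ]
  have h1 : d ⊓ d' ⋖ d := inf_covBy_of_covBy_sup_right (hsup.symm ▸ hd')
  have h2 : d ⊓ d' ⋖ d' := inf_covBy_of_covBy_sup_left (hsup.symm ▸ hd)
  refine ⟨hba.map_mkQ (hc.trans hcb.1.le), hcb.map_mkQ hc, ?_, ?_, ?_, ?_⟩
  · rw [eq_bot_iff]
    rintro _ ⟨⟨x, hx, rfl⟩, y, hy, hxy⟩
    have hyx : y - x ∈ d ⊓ d' := (Submodule.Quotient.eq _).mp hxy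
    have hx' : x ∈ d' := by simpa using sub_mem hy hyx.2
    exact (Submodule.Quotient.mk_eq_zero _).mpr ⟨hx, hx'⟩
  · rw [← Submodule.map_sup, hsup]
  · exact hbot ▸ h1.map_mkQ le_rfl
  · exact hbot ▸ h2.map_mkQ le_rfl

end Quotient

/-! ### The length formula. -/

/-- If every indecomposable module is `i`-factor serial with `i ≤ 4`, then a local `n`-factor
serial module with `n > 1` has length `n + 1`. -/
theorem length_eq_succ_of_isLocalModule {A : Type u} [Ring A]
    (hA : ∀ (L : Type u) [AddCommGroup L] [Module A L] [Module.Finite A L],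
      IsIndecomposableModule A L → ∃ i : ℕ, 1 ≤ i ∧ i ≤ 4 ∧ IsFactorSerial i A L)
    {M : Type u} [AddCommGroup M] [Module A M] (hloc : IsLocalModule A M)
    {n : ℕ} (hn : 1 < n) (hM : IsFactorSerial n A M) :
    Module.length A M = (n + 1 : ℕ) := by
  obtain ⟨l, hl, ⟨rfl, -⟩ | ⟨-, hnl, hu, hnu⟩⟩ := hM
  · exact absurd hn (lt_irrefl 1)
  obtain ⟨_, _⟩ := isFiniteLength_iff_isNoetherian_isArtinian.mp
    (Module.length_ne_top_iff.mp (hl ▸ ENat.natCast_ne_top l))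
  obtain ⟨t, rfl⟩ := Nat.exists_eq_add_of_le hnl
  rw [Nat.add_sub_cancel_left] at hu hnu
  obtain ⟨hchain, D, D', hne, hD, hD'⟩ := exists_covBy_radPow_ne hu hnu
  -- Here `t` is l - n; in the last case it has been shifted by 2, so the fork sits at `radPow A M
  -- (t + 2)`.
  rcases t with _ | _ | t
  · exact absurd (hloc.unique (covBy_top_iff.mp hD) (covBy_top_iff.mp hD')) hne
  · exact hl
  · have hf := isForkedChain_map_mkQ (hchain t (by omega)) (hchain (t + 1) (by omega)) hne hD hD'
    obtain ⟨i, -, hi, hs⟩ := hA _ hf.isIndecomposableModule_amalgam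
    exact absurd hs (not_isFactorSerial_of_sup_eq_top Amalgam.range_inl_sup_range_inr
      hf.range_inl_ne_top hf.range_inr_ne_top (l := 5) hf.length_amalgam (by omega))

theorem proposition2p4 (R : Type w) [CommRing R] [IsArtinianRing R]
    (Λ : Type u) [Ring Λ] [Algebra R Λ] [Module.Finite R Λ]
    (hΛ : IsRightNakayama 4 Λ)
    (M : Type u) [AddCommGroup M] [Module Λᵐᵒᵖ M] [Module.Finite Λᵐᵒᵖ M]
    (hM : IsIndecomposableModule Λᵐᵒᵖ M) (hloc : IsLocalModule Λᵐᵒᵖ M) :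
    (IsFactorSerial 4 Λᵐᵒᵖ M → Module.length Λᵐᵒᵖ M = 5) ∧
    (IsFactorSerial 3 Λᵐᵒᵖ M → Module.length Λᵐᵒᵖ M = 4) ∧
    (IsFactorSerial 2 Λᵐᵒᵖ M → Module.length Λᵐᵒᵖ M = 3) :=
  ⟨length_eq_succ_of_isLocalModule hΛ.1 hloc (by omega),
    length_eq_succ_of_isLocalModule hΛ.1 hloc (by omega),
    length_eq_succ_of_isLocalModule hΛ.1 hloc (by omega)⟩
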